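/- Let $k$ be a field, $S=k[x_0,\dots,x_n]$ with its standard grading, $\mathfrak p\subset S$ a homogeneous prime ideal, and $R=S/\mathfrak p$. Let $d\ge 1$ be an integer, let $M_1,\dots,M_N$ with $N=\binom{n+d}{d}$ be the monomials of degree $d$ in $S$, and for ${\bf a}=(a_1,\dots,a_N)\in k^N$ put $f_{\bf a}=\sum_{i=1}^N a_iM_i$. For every integer $j$ with $1\le j\le\dim R$ let $$\mathcal C_j=\{({\bf a}_1,\dots,{\bf a}_j)\in\mathbb P^{jN-1}(k):\ \operatorname{codim}_R\big((f_{{\bf a}_1},\dots,f_{{\bf a}_j})R\big)=j\},$$ where the codimension of an ideal is its height. Then $\mathcal C_j$ is open in $\mathbb P^{jN-1}(k)$ for the Zariski topology, whose closed sets are the zero loci of sets of homogeneous polynomials with coefficients in $k$. If $k$ is infinite, then $\mathcal C_j$ is non-empty. Moreover $\mathcal C_j$ is a proper subset of $\mathbb P^{jN-1}(k)$ if and only if $j\ge 2$ or $\mathfrak p$ contains a non-zero form of degree $d$ (so the only exception to properness is $j=1$ with $\mathfrak p_d=0$, where $\mathcal C_1=\mathbb P^{N-1}(k)$). -/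

import Mathlib

open scoped LinearAlgebra.Projectivization Topology

attribute [local instance] MvPolynomial.gradedAlgebra

noncomputable section

namespace PrincipalClass

open MvPolynomial

/-! ### The Zariski topology on the `k`-points of a projective space -/

/-- The common zeros, in the projective space on `k ^ σ`, of a set `T` of polynomials. It is only
used for sets of homogeneous polynomials, for which the choice of a representative is
irrelevant (`eval_rep_eq_zero_iff`). -/
def projZeroLocus {k σ : Type*} [Field k] (T : Set (MvPolynomial σ k)) : Set (ℙ k (σ → k)) :=
  {x | ∀ F ∈ T, eval x.rep F = 0}

/-- `Z` is the zero locus of a set of homogeneous polynomials. -/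
def IsProjAlgebraic {k σ : Type*} [Field k] (Z : Set (ℙ k (σ → k))) : Prop :=
  ∃ T : Set (MvPolynomial σ k), (∀ F ∈ T, ∃ e : ℕ, F.IsHomogeneous e) ∧ Z = projZeroLocus T

theorem eval_smul_eq {k σ : Type*} [Field k] {F : MvPolynomial σ k} {e : ℕ}
    (hF : F.IsHomogeneous e) (c : k) (v : σ → k) : eval (c • v) F = c ^ e * eval v F := by
  simp only [eval_eq, Finset.mul_sum]
  refine Finset.sum_congr rfl fun m hm => ?_
  have hdeg : e = ∑ i ∈ m.support, m i := hF.degree_eq_sum_deg_support hm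
  simp only [Pi.smul_apply, smul_eq_mul, mul_pow, Finset.prod_mul_distrib,
    Finset.prod_pow_eq_pow_sum, ← hdeg]
  ring

/-- Vanishing of a homogeneous polynomial does not depend on the representative. -/
theorem eval_rep_eq_zero_iff {k σ : Type*} [Field k] {F : MvPolynomial σ k} {e : ℕ}
    (hF : F.IsHomogeneous e) (v : σ → k) (hv : v ≠ 0) :
    eval (Projectivization.mk k v hv).rep F = 0 ↔ eval v F = 0 := by
  obtain ⟨c, hc⟩ := Projectivization.exists_smul_eq_mk_rep k v hv
  rw [← hc, Units.smul_def, eval_smul_eq hF]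
  simp

/-- The Zariski topology on the projective space on `k ^ σ`: the closed sets are the zero loci of
sets of homogeneous polynomials. -/
@[reducible] def zariskiTopology (k σ : Type*) [Field k] : TopologicalSpace (ℙ k (σ → k)) :=
  TopologicalSpace.ofClosed {Z | IsProjAlgebraic Z}
    ⟨{1}, by simpa using ⟨0, isHomogeneous_one σ k⟩, by ext; simp [projZeroLocus]⟩
    (by
      intro A hA
      choose! T hT hZ using fun Z (hZ : Z ∈ A) => (hA hZ : IsProjAlgebraic Z)
      refine ⟨⋃ Z ∈ A, T Z, ?_, ?_⟩
      · intro F hF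
        simp only [Set.mem_iUnion] at hF
        obtain ⟨Z, hZA, hF⟩ := hF
        exact hT Z hZA F hF
      · ext x
        simp only [Set.mem_sInter, projZeroLocus, Set.mem_iUnion, Set.mem_ofPred_eq]
        constructor
        · rintro h F ⟨Z, hZA, hF⟩
          have := h Z hZA
          rw [hZ Z hZA] at this
          exact this F hF
        · intro h Z hZA
          rw [hZ Z hZA]
          exact fun F hF => h F ⟨Z, hZA, hF⟩)
    (by
      rintro _ ⟨T, hT, rfl⟩ _ ⟨T', hT', rfl⟩
      refine ⟨{H | ∃ F ∈ T, ∃ G ∈ T', H = F * G}, ?_, ?_⟩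
      · rintro _ ⟨F, hF, G, hG, rfl⟩
        obtain ⟨e, he⟩ := hT F hF
        obtain ⟨e', he'⟩ := hT' G hG
        exact ⟨e + e', he.mul he'⟩
      · ext x
        simp only [Set.mem_union, projZeroLocus, Set.mem_ofPred_eq]
        constructor
        · rintro (h | h) _ ⟨F, hF, G, hG, rfl⟩
          · simp [h F hF]
          · simp [h G hG]
        · intro h
          by_contra! hc
          obtain ⟨⟨F, hF, hF0⟩, ⟨G, hG, hG0⟩⟩ := hc
          have := h _ ⟨F, hF, G, hG, rfl⟩
          rw [map_mul] at this
          exact (mul_ne_zero hF0 hG0) this)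

/-! ### Tuples of forms of degree `d` -/

/-- The (exponents of the) monomials of degree `d` in the variables `x₀, …, xₙ`. -/
abbrev Monomials (n d : ℕ) : Type :=
  ↥(Finset.finsuppAntidiag (Finset.univ : Finset (Fin (n + 1))) d)

/-- The form `f_a = ∑ aᵢ Mᵢ` of degree `d` with coefficient vector `a`. -/
def form {k : Type*} [Field k] {n d : ℕ} (a : Monomials n d → k) :
    MvPolynomial (Fin (n + 1)) k :=
  ∑ m : Monomials n d, monomial (m : Fin (n + 1) →₀ ℕ) (a m)

/-- The ideal of `R = k[x₀, …, xₙ] / p` generated by the classes of the `j` forms of degree `d`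
with coefficient vectors `a (i, ·)`. -/
def formsIdeal {k : Type*} [Field k] {n d j : ℕ} (p : Ideal (MvPolynomial (Fin (n + 1)) k))
    (a : Fin j × Monomials n d → k) : Ideal (MvPolynomial (Fin (n + 1)) k ⧸ p) :=
  Ideal.span (Set.range fun i : Fin j => Ideal.Quotient.mk p (form fun m => a (i, m)))

/-- The locus `C_j` in the projective space on `k ^ (jN)` of those tuples of forms of degree `d`
whose ideal in `R = k[x₀, …, xₙ] / p` has codimension (height) `j`. -/
def principalLocus {k : Type*} [Field k] {n : ℕ} (p : Ideal (MvPolynomial (Fin (n + 1)) k))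
    (d j : ℕ) : Set (ℙ k (Fin j × Monomials n d → k)) :=
  {x | (formsIdeal p x.rep).height = j}

theorem formsIdeal_smul {k : Type*} [Field k] {n d j : ℕ}
    (p : Ideal (MvPolynomial (Fin (n + 1)) k)) (c : kˣ) (a : Fin j × Monomials n d → k) :
    formsIdeal p (c • a) = formsIdeal p a := by
  have key : ∀ (c : kˣ) (a : Fin j × Monomials n d → k),
      formsIdeal p (c • a) ≤ formsIdeal p a := by
    intro c a
    refine Ideal.span_le.2 ?_
    rintro _ ⟨i, rfl⟩
    have h : (form fun m => (c • a) (i, m)) = C (c : k) * form fun m => a (i, m) := by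
      simp [form, Finset.mul_sum, C_mul_monomial, Units.smul_def]
    simp only [h, map_mul]
    exact Ideal.mul_mem_left _ _ (Ideal.subset_span ⟨i, rfl⟩)
  refine le_antisymm (key c a) ?_
  simpa using key c⁻¹ (c • a)

/-- Membership in `C_j` does not depend on the representative. -/
theorem mk_mem_principalLocus {k : Type*} [Field k] {n d j : ℕ}
    (p : Ideal (MvPolynomial (Fin (n + 1)) k)) (a : Fin j × Monomials n d → k) (ha : a ≠ 0) :
    Projectivization.mk k a ha ∈ principalLocus p d j ↔ (formsIdeal p a).height = j := by
  obtain ⟨c, hc⟩ := Projectivization.exists_smul_eq_mk_rep k a ha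
  simp only [principalLocus, Set.mem_ofPred_eq, ← hc, formsIdeal_smul]

end PrincipalClass

end

/-! Let `m` be the irrelevant ideal of `R` and let `k` be infinite. Then `r = dim R` is the height
of `m`, and `j` forms of degree `d` generate an ideal of height `j` exactly when they can be
completed to `r` such forms generating an ideal whose radical contains `m`. Completion is prime
avoidance over an infinite field (`exists_extension_le_height`), after which
`irrelevantIdeal_le_radical` applies. Conversely, `r` forms of this kind make `R` integral over
`k[y₁, …, yᵣ]` (`isIntegral_aeval_form`). The map from the polynomial ring is injective for
dimension reasons, and going-down transports the height of `(y₁, …, yⱼ)` to `R`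
(`le_height_of_irrelevantIdeal_le_radical`). Openness follows because, with the completing forms
fixed, the condition on the radical is implied near a given tuple by the non-vanishing of a
determinant. Existence is completion of the empty tuple. Over a finite field the topology is
discrete. Properness reduces to Krull's bound and to tuples with a single non-zero entry. -/

/-! ### Heights and dimension over a polynomial ring -/

open MvPolynomial in
/-- A prime ideal of a polynomial ring over a field containing the first `j` variables has
height at least `j`. -/
theorem MvPolynomial.le_height_of_forall_X_mem {k : Type*} [Field k] {r : ℕ} (j : ℕ) (hj : j ≤ r)
    (Q : Ideal (MvPolynomial (Fin r) k)) [Q.IsPrime]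
    (hQ : ∀ i : Fin r, (i : ℕ) < j → X i ∈ Q) : (j : ℕ∞) ≤ Q.height := by
  -- Killing the first `i` variables is an endomorphism of a domain, so its kernel `P i` is prime.
  -- The `P i` form a strict chain, which bounds the height of `P j` below.
  let σ : ℕ → MvPolynomial (Fin r) k →ₐ[k] MvPolynomial (Fin r) k :=
    fun i => aeval fun l : Fin r => if (l : ℕ) < i then 0 else X l
  let P : ℕ → Ideal (MvPolynomial (Fin r) k) := fun i => RingHom.ker (σ i)
  have hP : ∀ i, (P i).IsPrime := fun i => RingHom.ker_isPrime _
  have hX : ∀ (i : ℕ) (l : Fin r), X l ∈ P i ↔ (l : ℕ) < i := by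
    intro i l
    simp only [P, σ, RingHom.mem_ker, aeval_X]
    split_ifs with h <;> simp [h, X_ne_zero]
  have hle : ∀ (i : ℕ) (Q : Ideal (MvPolynomial (Fin r) k)),
      (∀ l : Fin r, (l : ℕ) < i → X l ∈ Q) → P i ≤ Q := by
    intro i Q hQ f hf
    have h : (Ideal.Quotient.mkₐ k Q).comp (σ i) = Ideal.Quotient.mkₐ k Q := by
      refine algHom_ext fun l => ?_
      simp only [AlgHom.comp_apply, σ, aeval_X]
      split_ifs with h
      · rw [map_zero]
        exact (Ideal.Quotient.eq_zero_iff_mem.2 (hQ l h)).symm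
      · rfl
    have h2 := DFunLike.congr_fun h f
    rw [AlgHom.comp_apply, (RingHom.mem_ker).1 hf, map_zero] at h2
    exact Ideal.Quotient.eq_zero_iff_mem.1 h2.symm
  have key : ∀ i ≤ r, (i : ℕ∞) ≤ (P i).height := by
    intro i
    induction i with
    | zero => simp
    | succ i ih =>
      intro hi
      have hlt : P i < P (i + 1) := by
        refine lt_of_le_of_ne (hle i _ fun l hl => (hX _ l).2 (by omega)) fun h => ?_
        have : (X (⟨i, by omega⟩ : Fin r) : MvPolynomial (Fin r) k) ∈ P i :=
          h ▸ (hX _ _).2 (by simp)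
        simpa using (hX _ _).1 this
      have := hP i
      have := hP (i + 1)
      refine le_trans ?_ (Ideal.height_add_one_le_of_lt_of_isPrime hlt)
      push_cast
      gcongr
      exact ih (by omega)
  exact (key j hj).trans (Ideal.height_mono (hle j Q hQ))

theorem ringKrullDim_le_of_isIntegral (A B : Type*) [CommRing A] [CommRing B] [Algebra A B]
    [Algebra.IsIntegral A B] : ringKrullDim B ≤ ringKrullDim A :=
  Order.krullDim_le_of_strictMono (PrimeSpectrum.comap (algebraMap A B)) fun _ _ h =>
    Ideal.IsIntegral.comap_lt_comap h

open MvPolynomial in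
theorem MvPolynomial.ringKrullDim_fin (k : Type*) [Field k] (r : ℕ) :
    ringKrullDim (MvPolynomial (Fin r) k) = r := by
  simp [ringKrullDim_eq_zero_of_field]

-- A non-zero kernel element is a non-zero-divisor, so the image would have dimension below `r`. But
-- `R` is integral over the image and has dimension at least `r`.
open MvPolynomial in
theorem MvPolynomial.algebraMap_injective_of_isIntegral_of_le_ringKrullDim {k R : Type*} [Field k]
    [CommRing R] {r : ℕ} [Algebra (MvPolynomial (Fin r) k) R]
    [Algebra.IsIntegral (MvPolynomial (Fin r) k) R] (hr : (r : WithBot ℕ∞) ≤ ringKrullDim R) :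
    Function.Injective (algebraMap (MvPolynomial (Fin r) k) R) := by
  rw [injective_iff_map_eq_zero]
  intro f hf
  by_contra hf0
  let φ := algebraMap (MvPolynomial (Fin r) k) R
  let B := φ.range
  have h1 : ringKrullDim B + 1 ≤ r := by
    rw [← ringKrullDim_fin k r]
    exact ringKrullDim_succ_le_of_surjective φ.rangeRestrict φ.rangeRestrict_surjective
      (mem_nonZeroDivisors_of_ne_zero hf0) (Subtype.ext hf)
  have : Algebra.IsIntegral B R := by
    refine ⟨fun x => ?_⟩
    obtain ⟨p, hp, hp0⟩ := Algebra.IsIntegral.isIntegral (R := MvPolynomial (Fin r) k) x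
    refine ⟨p.map φ.rangeRestrict, hp.map _, ?_⟩
    rw [Polynomial.eval₂_map]
    exact hp0
  have h2 : ringKrullDim R ≤ ringKrullDim B := ringKrullDim_le_of_isIntegral B R
  have h3 : (r : WithBot ℕ∞) + 1 ≤ r := (add_le_add_left (hr.trans h2) 1).trans h1
  have h4 : ((r + 1 : ℕ) : WithBot ℕ∞) ≤ (r : ℕ) := by exact_mod_cast h3
  have := Nat.cast_le.1 h4
  omega

open MvPolynomial in
/-- If a Noetherian domain of dimension at least `r` is integral over `k[y₁, …, yᵣ]`, then the
images of the first `j` variables generate an ideal of height at least `j`. -/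
theorem MvPolynomial.le_height_of_isIntegral_of_forall_X_mem {k R : Type*} [Field k]
    [CommRing R] [IsDomain R] [IsNoetherianRing R] {r : ℕ} [Algebra (MvPolynomial (Fin r) k) R]
    [Algebra.IsIntegral (MvPolynomial (Fin r) k) R] (hr : (r : WithBot ℕ∞) ≤ ringKrullDim R)
    (j : ℕ) (hj : j ≤ r) (I : Ideal R)
    (hI : ∀ i : Fin r, (i : ℕ) < j → algebraMap (MvPolynomial (Fin r) k) R (X i) ∈ I) :
    (j : ℕ∞) ≤ I.height := by
  have hinj := algebraMap_injective_of_isIntegral_of_le_ringKrullDim (k := k) hr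
  have : FaithfulSMul (MvPolynomial (Fin r) k) R := (faithfulSMul_iff_algebraMap_injective _ _).2 hinj
  rw [Ideal.height_eq_inf_minimalPrimes]
  refine le_iInf₂ fun q hq => ?_
  have := hq.isPrime
  -- Going-down holds because the polynomial ring is integrally closed and embeds in the domain `R`.
  -- Only the height of the contraction is needed; the fibre term is dropped.
  rw [Ideal.height_eq_height_add_of_liesOver_of_hasGoingDown
    (q.under (MvPolynomial (Fin r) k)) q]
  refine le_trans (le_height_of_forall_X_mem j hj _ fun i hi => ?_) le_self_add
  exact hq.le (hI i hi)

noncomputable section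

namespace PrincipalClass

open MvPolynomial

/-! ### Coefficient vectors and forms -/

section Forms

variable {k : Type*} [Field k] {n d : ℕ}

theorem mem_finsuppAntidiag_univ_iff {m : Fin (n + 1) →₀ ℕ} :
    m ∈ Finset.finsuppAntidiag (Finset.univ : Finset (Fin (n + 1))) d ↔ m.degree = d := by
  simp [Finset.mem_finsuppAntidiag, Finsupp.degree_eq_sum]

theorem degree_monomials (m : Monomials n d) : (m : Fin (n + 1) →₀ ℕ).degree = d :=
  mem_finsuppAntidiag_univ_iff.1 m.2

theorem coeff_form (a : Monomials n d → k) (m : Monomials n d) :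
    coeff (m : Fin (n + 1) →₀ ℕ) (form a) = a m := by
  simp [form, coeff_sum, coeff_monomial]

theorem isHomogeneous_form (a : Monomials n d → k) : (form a).IsHomogeneous d :=
  IsHomogeneous.sum _ _ _ fun m _ => isHomogeneous_monomial _ (degree_monomials m)

theorem form_coeff {f : MvPolynomial (Fin (n + 1)) k} (hf : f.IsHomogeneous d) :
    form (fun m : Monomials n d => coeff (m : Fin (n + 1) →₀ ℕ) f) = f := by
  ext m
  by_cases hm : m.degree = d
  · exact coeff_form _ ⟨m, mem_finsuppAntidiag_univ_iff.2 hm⟩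
  · rw [(isHomogeneous_form _).coeff_eq_zero hm, hf.coeff_eq_zero hm]

theorem form_zero : form (0 : Monomials n d → k) = 0 := by simp [form]

theorem form_add (a b : Monomials n d → k) : form (a + b) = form a + form b := by
  simp [form, Finset.sum_add_distrib]

theorem form_smul (c : k) (a : Monomials n d → k) : form (c • a) = C c * form a := by
  simp [form, Finset.mul_sum, C_mul_monomial]

theorem form_eq_zero_iff (a : Monomials n d → k) : form a = 0 ↔ a = 0 := by
  refine ⟨fun h => funext fun m => ?_, fun h => h ▸ form_zero⟩
  rw [← coeff_form a m, h, coeff_zero, Pi.zero_apply]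

theorem mem_idealOfVars_of_isHomogeneous {f : MvPolynomial (Fin (n + 1)) k} {e : ℕ}
    (hf : f.IsHomogeneous e) : f ∈ idealOfVars (Fin (n + 1)) k ^ e :=
  (mem_pow_idealOfVars_iff' _ _).2 fun _ hm => hf.coeff_eq_zero hm.ne

theorem form_mem_idealOfVars (hd : 1 ≤ d) (a : Monomials n d → k) :
    form a ∈ idealOfVars (Fin (n + 1)) k :=
  Ideal.pow_le_self (by omega) (mem_idealOfVars_of_isHomogeneous (isHomogeneous_form a))

end Forms

/-! ### The irrelevant ideal, Krull's bound and prime avoidance -/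

section Ideals

variable {k : Type*} [Field k] {n d j : ℕ} (p : Ideal (MvPolynomial (Fin (n + 1)) k))

/-- The ideal of `k[x₀, …, xₙ] / p` generated by the classes of the variables. -/
def irrelevantIdeal : Ideal (MvPolynomial (Fin (n + 1)) k ⧸ p) :=
  (idealOfVars (Fin (n + 1)) k).map (Ideal.Quotient.mk p)

theorem idealOfVars_isPrime (σ : Type*) : (idealOfVars σ k).IsPrime := by
  have h : idealOfVars σ k = RingHom.ker (constantCoeff (R := k) (σ := σ)) := by
    ext f
    rw [← pow_one (idealOfVars σ k), mem_pow_idealOfVars_iff', RingHom.mem_ker,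
      constantCoeff_eq]
    exact ⟨fun h => h 0 (by simp), fun h x hx => by
      rw [Nat.lt_one_iff, Finsupp.degree_eq_zero_iff] at hx
      rwa [hx]⟩
  rw [h]
  exact RingHom.ker_isPrime _

/-- The constant term of an element of a homogeneous ideal lies in the ideal, and would be a unit if
non-zero. -/
theorem le_idealOfVars {I : Ideal (MvPolynomial (Fin (n + 1)) k)} (hI : I ≠ ⊤)
    (hhom : I.IsHomogeneous (homogeneousSubmodule (Fin (n + 1)) k)) :
    I ≤ idealOfVars (Fin (n + 1)) k := by
  intro f hf
  rw [← pow_one (idealOfVars _ k), mem_pow_idealOfVars_iff']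
  intro x hx
  rw [Nat.lt_one_iff, Finsupp.degree_eq_zero_iff] at hx
  subst hx
  have h := homogeneousComponent_mem_of_mem hhom hf 0
  rw [homogeneousComponent_zero] at h
  by_contra h0
  exact hI (Ideal.eq_top_of_isUnit_mem _ h ((isUnit_iff_ne_zero.2 h0).map C))

variable {p}

theorem irrelevantIdeal_isPrime (hp : p ≠ ⊤)
    (hhom : p.IsHomogeneous (homogeneousSubmodule (Fin (n + 1)) k)) :
    (irrelevantIdeal p).IsPrime := by
  have := idealOfVars_isPrime (k := k) (Fin (n + 1))
  exact Ideal.map_isPrime_of_surjective Ideal.Quotient.mk_surjective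
    (by rw [Ideal.mk_ker]; exact le_idealOfVars hp hhom)

variable (p)

theorem comap_formsIdeal (a : Fin j × Monomials n d → k) :
    (formsIdeal p a).comap (Ideal.Quotient.mk p) =
      Ideal.span (Set.range fun i : Fin j => form fun m => a (i, m)) ⊔ p := by
  have h : formsIdeal p a = (Ideal.span (Set.range fun i : Fin j => form fun m => a (i, m))).map
      (Ideal.Quotient.mk p) := by
    rw [formsIdeal, Ideal.map_span, ← Set.range_comp]
    rfl
  rw [h, Ideal.comap_map_of_surjective' _ Ideal.Quotient.mk_surjective, Ideal.mk_ker]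

variable {p}

theorem isHomogeneous_comap_formsIdeal
    (hhom : p.IsHomogeneous (homogeneousSubmodule (Fin (n + 1)) k))
    (a : Fin j × Monomials n d → k) :
    ((formsIdeal p a).comap (Ideal.Quotient.mk p)).IsHomogeneous
      (homogeneousSubmodule (Fin (n + 1)) k) := by
  rw [comap_formsIdeal]
  refine Ideal.IsHomogeneous.sup (Ideal.homogeneous_span _ _ ?_) hhom
  rintro _ ⟨i, rfl⟩
  exact ⟨d, isHomogeneous_form _⟩

theorem formsIdeal_le_irrelevantIdeal (hd : 1 ≤ d) (a : Fin j × Monomials n d → k) :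
    formsIdeal p a ≤ irrelevantIdeal p := by
  refine Ideal.span_le.2 ?_
  rintro _ ⟨i, rfl⟩
  exact Ideal.mem_map_of_mem _ (form_mem_idealOfVars hd _)

theorem formsIdeal_ne_top (hp : p ≠ ⊤)
    (hhom : p.IsHomogeneous (homogeneousSubmodule (Fin (n + 1)) k)) (hd : 1 ≤ d)
    (a : Fin j × Monomials n d → k) : formsIdeal p a ≠ ⊤ :=
  fun h => (irrelevantIdeal_isPrime hp hhom).ne_top
    (top_le_iff.1 (h ▸ formsIdeal_le_irrelevantIdeal hd a))

/-- Krull's height theorem. The condition `1 ≤ d` makes the ideal proper. -/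
theorem height_formsIdeal_le (hp : p ≠ ⊤)
    (hhom : p.IsHomogeneous (homogeneousSubmodule (Fin (n + 1)) k)) (hd : 1 ≤ d)
    (a : Fin j × Monomials n d → k) : (formsIdeal p a).height ≤ j := by
  refine (Ideal.height_le_spanFinrank _ (formsIdeal_ne_top hp hhom hd a)).trans ?_
  refine (Submodule.spanFinrank_span_le_encard _).trans ?_
  rw [← Set.image_univ]
  refine (Set.encard_image_le _ _).trans ?_
  simp

theorem formsIdeal_mono {i : ℕ} (a : Fin i × Monomials n d → k) (b : Fin j × Monomials n d → k)
    (h : ∀ l : Fin i, ∃ l' : Fin j, ∀ m, b (l', m) = a (l, m)) :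
    formsIdeal p a ≤ formsIdeal p b := by
  refine Ideal.span_le.2 ?_
  rintro _ ⟨l, rfl⟩
  obtain ⟨l', hl'⟩ := h l
  refine Ideal.subset_span ⟨l', ?_⟩
  simp [hl']

/-- A prime ideal containing all forms of degree `d` contains the irrelevant ideal. -/
theorem irrelevantIdeal_le_of_forall_form_mem (q : Ideal (MvPolynomial (Fin (n + 1)) k ⧸ p))
    [q.IsPrime] (h : ∀ a : Monomials n d → k, Ideal.Quotient.mk p (form a) ∈ q) :
    irrelevantIdeal p ≤ q := by
  rw [irrelevantIdeal, Ideal.map_le_iff_le_comap, idealOfVars, Ideal.span_le]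
  rintro _ ⟨i, rfl⟩
  have h1 := h (fun m => coeff (m : Fin (n + 1) →₀ ℕ) (X i ^ d))
  rw [form_coeff (isHomogeneous_X_pow i d), map_pow] at h1
  exact Ideal.IsPrime.mem_of_pow_mem (I := q) ‹_› d h1

/-- A tuple of `i` forms of the same degree generating an ideal of height at least `i` can be
extended by one form, as long as `i` is smaller than the height of the irrelevant ideal. -/
theorem exists_snoc_le_height [Infinite k] {i : ℕ} (a : Fin i × Monomials n d → k)
    (ha : (i : ℕ∞) ≤ (formsIdeal p a).height) (hi : (i : ℕ∞) < (irrelevantIdeal p).height) :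
    ∃ b : Fin (i + 1) × Monomials n d → k, (∀ l m, b (Fin.castSucc l, m) = a (l, m)) ∧
      ((i + 1 : ℕ) : ℕ∞) ≤ (formsIdeal p b).height := by
  -- Forms with class in `q` give a linear subspace, and a vector space over an infinite field is
  -- not a finite union of proper subspaces.
  let V (q : Ideal (MvPolynomial (Fin (n + 1)) k ⧸ p)) : Subspace k (Monomials n d → k) :=
    { carrier := {c | Ideal.Quotient.mk p (form c) ∈ q}
      add_mem' := fun {c c'} hc hc' => by
        simp only [Set.mem_ofPred_eq, form_add, map_add] at *
        exact q.add_mem hc hc'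
      zero_mem' := by simp [form_zero]
      smul_mem' := fun t c hc => by
        simp only [Set.mem_ofPred_eq, form_smul, map_mul] at *
        exact q.mul_mem_left _ hc }
  -- Only minimal primes of height exactly `i` need avoiding; any other already has height at least
  -- `i + 1`.
  let M := {q ∈ (formsIdeal p a).minimalPrimes | q.height = i}
  have hM : Finite M :=
    ((Ideal.finite_minimalPrimes_of_isNoetherianRing _ (formsIdeal p a)).subset
      (Set.sep_subset _ _)).to_subtype
  obtain ⟨c, hc⟩ : ∃ c, ∀ q ∈ M, Ideal.Quotient.mk p (form c) ∉ q := by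
    by_contra! hcon
    obtain ⟨q, hq⟩ := Subspace.exists_eq_top_of_iUnion_eq_univ (p := fun q : M => V q.1)
      (Set.eq_univ_of_forall fun c => by
        obtain ⟨q, hq, hcq⟩ := hcon c
        exact Set.mem_iUnion.2 ⟨⟨q, hq⟩, hcq⟩)
    have := q.2.1.isPrime
    have hle := irrelevantIdeal_le_of_forall_form_mem (d := d) q.1 fun c =>
      (show c ∈ V q.1 from hq ▸ Submodule.mem_top)
    exact (hi.trans_le (Ideal.height_mono hle)).ne q.2.2.symm
  refine ⟨fun x => Fin.snoc (α := fun _ => Monomials n d → k) (fun l m => a (l, m)) c x.1 x.2,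
    by simp, ?_⟩
  set b : Fin (i + 1) × Monomials n d → k :=
    fun x => Fin.snoc (α := fun _ => Monomials n d → k) (fun l m => a (l, m)) c x.1 x.2 with hb
  have hab : formsIdeal p a ≤ formsIdeal p b :=
    formsIdeal_mono a b fun l => ⟨Fin.castSucc l, by simp [hb]⟩
  have hcb : Ideal.Quotient.mk p (form c) ∈ formsIdeal p b :=
    Ideal.subset_span ⟨Fin.last i, by simp [hb]⟩
  rw [Ideal.height_eq_inf_minimalPrimes]
  refine le_iInf₂ fun q hq => ?_
  have := hq.isPrime
  obtain ⟨q', hq', hle⟩ := Ideal.exists_minimalPrimes_le (hab.trans hq.le)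
  have := hq'.isPrime
  have hi' : (i : ℕ∞) ≤ q'.height := ha.trans (Ideal.height_mono hq'.le)
  push_cast
  rcases hi'.lt_or_eq with h | h
  · exact (Order.add_one_le_of_lt h).trans (Ideal.height_mono hle)
  · have hlt : q' < q := lt_of_le_of_ne hle fun he =>
      hc q' ⟨hq', h.symm⟩ (he ▸ hq.le hcb)
    rw [h]
    exact Ideal.height_add_one_le_of_lt_of_isPrime hlt

theorem exists_extension_le_height [Infinite k] {i : ℕ} (a : Fin i × Monomials n d → k)
    (ha : (i : ℕ∞) ≤ (formsIdeal p a).height) (r : ℕ) (hir : i ≤ r)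
    (hr : (r : ℕ∞) ≤ (irrelevantIdeal p).height) :
    ∃ b : Fin r × Monomials n d → k, (∀ l m, b (Fin.castLE hir l, m) = a (l, m)) ∧
      (r : ℕ∞) ≤ (formsIdeal p b).height := by
  induction r, hir using Nat.le_induction with
  | base => exact ⟨a, fun l m => rfl, ha⟩
  | succ r hir ih =>
    obtain ⟨b, hb, hbr⟩ := ih (le_trans (by simp) hr)
    obtain ⟨b', hb', hbr'⟩ := exists_snoc_le_height b hbr
      (lt_of_lt_of_le (Nat.cast_lt.2 (Nat.lt_succ_self r)) hr)
    exact ⟨b', fun l m => (hb' (Fin.castLE hir l) m).trans (hb l m), hbr'⟩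

/-- Any prime over the ideal contains its homogeneous core, which is again a prime over the ideal.
The core has height at least `r` and sits inside the irrelevant ideal, of height at most `r`, so the
two coincide. -/
theorem irrelevantIdeal_le_radical (hp : p.IsPrime)
    (hhom : p.IsHomogeneous (homogeneousSubmodule (Fin (n + 1)) k))
    {r : ℕ} (b : Fin r × Monomials n d → k) (hb : (r : ℕ∞) ≤ (formsIdeal p b).height)
    (hr : (irrelevantIdeal p).height ≤ r) :
    irrelevantIdeal p ≤ (formsIdeal p b).radical := by
  rw [Ideal.radical_eq_sInf]
  refine le_sInf fun q ⟨hbq, hq⟩ => ?_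
  have hmk : Function.Surjective (Ideal.Quotient.mk p) := Ideal.Quotient.mk_surjective
  let Q := ((q.comap (Ideal.Quotient.mk p)).homogeneousCore
    (homogeneousSubmodule (Fin (n + 1)) k)).toIdeal
  have hQ : Q.IsPrime := (hq.comap (Ideal.Quotient.mk p)).homogeneousCore
  have hQq : Q ≤ q.comap (Ideal.Quotient.mk p) := Ideal.toIdeal_homogeneousCore_le _ _
  have hbQ : (formsIdeal p b).comap (Ideal.Quotient.mk p) ≤ Q := by
    rw [← (isHomogeneous_comap_formsIdeal hhom b).toIdeal_homogeneousCore_eq_self]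
    exact Ideal.homogeneousCore_mono _ (Ideal.comap_mono hbq)
  have hker : RingHom.ker (Ideal.Quotient.mk p) ≤ Q := le_trans (Ideal.ker_le_comap _) hbQ
  have hQ' : (Q.map (Ideal.Quotient.mk p)).IsPrime := Ideal.map_isPrime_of_surjective hmk hker
  have h1 : formsIdeal p b ≤ Q.map (Ideal.Quotient.mk p) := by
    rw [← Ideal.map_comap_of_surjective _ hmk (formsIdeal p b)]
    exact Ideal.map_mono hbQ
  have h2 : Q.map (Ideal.Quotient.mk p) ≤ irrelevantIdeal p :=
    Ideal.map_mono (le_idealOfVars hQ.ne_top (HomogeneousIdeal.isHomogeneous _))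
  have h3 : Q.map (Ideal.Quotient.mk p) = irrelevantIdeal p := by
    by_contra hne
    have := irrelevantIdeal_isPrime hp.ne_top hhom
    have h4 := Ideal.height_add_one_le_of_lt_of_isPrime (lt_of_le_of_ne h2 hne)
    have h5 : ((r + 1 : ℕ) : ℕ∞) ≤ (r : ℕ) := by
      push_cast
      exact le_trans (by gcongr; exact hb.trans (Ideal.height_mono h1)) (h4.trans hr)
    have := Nat.cast_le.1 h5
    omega
  rw [← h3]
  exact Ideal.map_le_iff_le_comap.2 hQq

end Ideals

/-! ### Noether normalization by forms of degree `d` -/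

section Finiteness

variable {k : Type*} [Field k] {n d : ℕ} {p : Ideal (MvPolynomial (Fin (n + 1)) k)}

theorem homogeneousComponent_mul_of_isHomogeneous {σ : Type*} {F : MvPolynomial σ k} {d : ℕ}
    (hF : F.IsHomogeneous d) (H : MvPolynomial σ k) {e : ℕ} (he : d ≤ e) :
    homogeneousComponent e (F * H) = F * homogeneousComponent (e - d) H := by
  have h := DirectSum.coe_decompose_mul_of_left_mem_of_le (homogeneousSubmodule σ k)
    (b := H) ((mem_homogeneousSubmodule _ _).2 hF) he
  rwa [← decomposition.decompose'_apply, ← decomposition.decompose'_apply]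

/-- If the classes of the forms `f₁, …, fᵣ` generate an ideal whose radical contains all
variables, then `k[x₀, …, xₙ] / p` is integral over `k[y₁, …, yᵣ]`, where `yᵢ` acts as `fᵢ`. -/
theorem isIntegral_aeval_form (hd : 1 ≤ d)
    (hhom : p.IsHomogeneous (homogeneousSubmodule (Fin (n + 1)) k)) {r : ℕ}
    (b : Fin r × Monomials n d → k) (hb : irrelevantIdeal p ≤ (formsIdeal p b).radical) :
    (aeval fun i : Fin r => Ideal.Quotient.mk p (form fun m => b (i, m)) :
      MvPolynomial (Fin r) k →ₐ[k] _).toRingHom.IsIntegral := by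
  set φ : MvPolynomial (Fin r) k →ₐ[k] (MvPolynomial (Fin (n + 1)) k ⧸ p) :=
    aeval fun i : Fin r => Ideal.Quotient.mk p (form fun m => b (i, m)) with hφ
  let _ : Algebra (MvPolynomial (Fin r) k) (MvPolynomial (Fin (n + 1)) k ⧸ p) :=
    φ.toRingHom.toAlgebra
  let _ : Module (MvPolynomial (Fin r) k) (MvPolynomial (Fin (n + 1)) k ⧸ p) :=
    Algebra.toModule
  have hsmul : ∀ (a : MvPolynomial (Fin r) k) (x : MvPolynomial (Fin (n + 1)) k ⧸ p),
      a • x = φ a * x := fun _ _ => rfl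
  have hle : idealOfVars (Fin (n + 1)) k ≤
      ((formsIdeal p b).comap (Ideal.Quotient.mk p)).radical := by
    rw [← Ideal.comap_radical]
    exact Ideal.map_le_iff_le_comap.1 hb
  obtain ⟨N, hN⟩ := Ideal.exists_pow_le_of_le_radical_of_fg hle (idealOfVars_fg _ _)
  -- From degree `N + d` on, a form lies in the ideal (degree at least `N`) and the degree of its
  -- coefficients, lower by `d`, is given by an honest subtraction.
  let W : Submodule (MvPolynomial (Fin r) k) (MvPolynomial (Fin (n + 1)) k ⧸ p) :=
    Submodule.span _ (Set.range fun x : Σ e : Fin (N + d), Monomials n e =>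
      Ideal.Quotient.mk p (monomial (x.2 : Fin (n + 1) →₀ ℕ) 1))
  have key : ∀ (e : ℕ) (G : MvPolynomial (Fin (n + 1)) k), G.IsHomogeneous e →
      Ideal.Quotient.mk p G ∈ W := by
    intro e
    induction e using Nat.strong_induction_on with
    | _ e ih =>
      intro G hG
      rcases lt_or_ge e (N + d) with he | he
      · rw [← form_coeff hG, form, map_sum]
        refine W.sum_mem fun m _ => ?_
        have : Ideal.Quotient.mk p (monomial (m : Fin (n + 1) →₀ ℕ) (coeff ↑m G)) =
            (C (coeff (m : Fin (n + 1) →₀ ℕ) G) : MvPolynomial (Fin r) k) •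
              Ideal.Quotient.mk p (monomial (m : Fin (n + 1) →₀ ℕ) 1) := by
          have hC : φ (C (coeff (m : Fin (n + 1) →₀ ℕ) G)) =
              Ideal.Quotient.mk p (C (coeff (m : Fin (n + 1) →₀ ℕ) G)) := φ.commutes _
          rw [hsmul, hC, ← map_mul, C_mul_monomial, mul_one]
        rw [this]
        exact W.smul_mem _ (Submodule.subset_span ⟨⟨⟨e, he⟩, m⟩, rfl⟩)
      · have hGmem : Ideal.Quotient.mk p G ∈ formsIdeal p b :=
          hN (Ideal.pow_le_pow_right (by omega) (mem_idealOfVars_of_isHomogeneous hG))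
        obtain ⟨c, hc⟩ := (Ideal.mem_span_range_iff_exists_fun).1 hGmem
        choose H hH using fun i => Ideal.Quotient.mk_surjective (c i)
        have h1 : G - ∑ i, (form fun m => b (i, m)) * H i ∈ p := by
          rw [← Ideal.Quotient.eq_zero_iff_mem, map_sub, map_sum, ← hc, sub_eq_zero]
          exact Finset.sum_congr rfl fun i _ => by rw [map_mul, hH, mul_comm]
        -- As `p` is homogeneous, the relation may be cut down to degree `e`; its coefficients then
        -- have degree `e - d < e`, and induction applies.
        have h2 := homogeneousComponent_mem_of_mem hhom h1 e
        rw [map_sub, map_sum, homogeneousComponent_eq_self hG, ← Ideal.Quotient.eq_zero_iff_mem,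
          map_sub, sub_eq_zero, map_sum] at h2
        rw [h2]
        refine W.sum_mem fun i _ => ?_
        rw [homogeneousComponent_mul_of_isHomogeneous (isHomogeneous_form _) _ (by omega),
          map_mul]
        have h3 : Ideal.Quotient.mk p (form fun m => b (i, m)) = φ (X i) := by
          rw [hφ, aeval_X]
        rw [h3, ← hsmul]
        exact W.smul_mem _ (ih (e - d) (by omega) _ (homogeneousComponent_isHomogeneous _ _))
  have htop : W = ⊤ := by
    rw [eq_top_iff]
    rintro x -
    obtain ⟨f, rfl⟩ := Ideal.Quotient.mk_surjective x
    rw [← sum_homogeneousComponent f, map_sum]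
    exact W.sum_mem fun e _ => key e _ (homogeneousComponent_isHomogeneous _ _)
  have hfin : Module.Finite (MvPolynomial (Fin r) k) (MvPolynomial (Fin (n + 1)) k ⧸ p) :=
    ⟨htop ▸ Submodule.fg_span (Set.finite_range _)⟩
  exact (RingHom.Finite.to_isIntegral (f := φ.toRingHom) hfin)

/-- The first `j` of `r = dim R` forms of degree `d` generating an ideal primary to the irrelevant
ideal of `R = k[x₀, …, xₙ] / p` generate an ideal of height `j`. -/
theorem le_height_of_irrelevantIdeal_le_radical (hp : p.IsPrime) (hd : 1 ≤ d)
    (hhom : p.IsHomogeneous (homogeneousSubmodule (Fin (n + 1)) k)) {r j : ℕ}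
    (hr : (r : WithBot ℕ∞) ≤ ringKrullDim (MvPolynomial (Fin (n + 1)) k ⧸ p)) (hj : j ≤ r)
    (b : Fin r × Monomials n d → k) (hb : irrelevantIdeal p ≤ (formsIdeal p b).radical)
    (a : Fin j × Monomials n d → k) (hab : ∀ l m, b (Fin.castLE hj l, m) = a (l, m)) :
    (j : ℕ∞) ≤ (formsIdeal p a).height := by
  have hint := isIntegral_aeval_form hd hhom b hb
  set φ : MvPolynomial (Fin r) k →ₐ[k] (MvPolynomial (Fin (n + 1)) k ⧸ p) :=
    aeval fun i : Fin r => Ideal.Quotient.mk p (form fun m => b (i, m)) with hφ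
  let _ : Algebra (MvPolynomial (Fin r) k) (MvPolynomial (Fin (n + 1)) k ⧸ p) :=
    φ.toRingHom.toAlgebra
  have : Algebra.IsIntegral (MvPolynomial (Fin r) k) (MvPolynomial (Fin (n + 1)) k ⧸ p) := ⟨hint⟩
  refine le_height_of_isIntegral_of_forall_X_mem (k := k) hr j hj _ fun i hi => ?_
  have h : φ (X i) ∈ formsIdeal p a := by
    rw [hφ, aeval_X]
    refine Ideal.subset_span ⟨⟨i, hi⟩, ?_⟩
    simp only [← hab]
    rfl
  exact h

/-- The dimension of `k[x₀, …, xₙ] / p` is the height of its irrelevant ideal. -/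
theorem ringKrullDim_eq_height_irrelevantIdeal [Infinite k] (hp : p.IsPrime)
    (hhom : p.IsHomogeneous (homogeneousSubmodule (Fin (n + 1)) k)) :
    ringKrullDim (MvPolynomial (Fin (n + 1)) k ⧸ p) = (irrelevantIdeal p).height := by
  have := irrelevantIdeal_isPrime hp.ne_top hhom
  refine le_antisymm ?_ Ideal.height_le_ringKrullDim_of_isPrime
  obtain ⟨r, hr⟩ := ENat.ne_top_iff_exists.1 (Ideal.height_ne_top_of_isPrime (I := irrelevantIdeal p))
  -- Linear forms suffice here: the dimension does not involve `d`.
  obtain ⟨b, -, hb⟩ := exists_extension_le_height (p := p) (d := 1)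
    (0 : Fin 0 × Monomials n 1 → k) (by simp) r (Nat.zero_le r) hr.le
  have hint := isIntegral_aeval_form le_rfl hhom b (irrelevantIdeal_le_radical hp hhom b hb hr.ge)
  let _ : Algebra (MvPolynomial (Fin r) k) (MvPolynomial (Fin (n + 1)) k ⧸ p) :=
    (aeval fun i : Fin r => Ideal.Quotient.mk p (form fun m => b (i, m)) :
      MvPolynomial (Fin r) k →ₐ[k] _).toRingHom.toAlgebra
  have : Algebra.IsIntegral (MvPolynomial (Fin r) k) (MvPolynomial (Fin (n + 1)) k ⧸ p) := ⟨hint⟩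
  rw [← hr]
  exact (ringKrullDim_le_of_isIntegral (MvPolynomial (Fin r) k) _).trans
    (ringKrullDim_fin k r).le

end Finiteness

/-! ### Open sets of projective space -/

section ZariskiTopology

variable {k σ : Type*} [Field k]

theorem isOpen_of_forall_exists_isHomogeneous {U : Set (ℙ k (σ → k))}
    (h : ∀ x ∈ U, ∃ (e : ℕ) (F : MvPolynomial σ k), F.IsHomogeneous e ∧ eval x.rep F ≠ 0 ∧
      ∀ y ∉ U, eval y.rep F = 0) : IsOpen[zariskiTopology k σ] U := by
  change IsProjAlgebraic Uᶜ
  refine ⟨{F | (∃ e : ℕ, F.IsHomogeneous e) ∧ ∀ y ∉ U, eval y.rep F = 0}, fun F hF => hF.1, ?_⟩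
  ext x
  refine ⟨fun hx F hF => hF.2 x hx, fun hx hxU => ?_⟩
  obtain ⟨e, F, hF, hFx, hFU⟩ := h x hxU
  exact hFx (hx F ⟨⟨e, hF⟩, hFU⟩)

theorem exists_linear_form_separating {x y : ℙ k (σ → k)} (hxy : x ≠ y) :
    ∃ F : MvPolynomial σ k, F.IsHomogeneous 1 ∧ eval x.rep F ≠ 0 ∧ eval y.rep F = 0 := by
  by_contra! hcon
  apply hxy
  obtain ⟨i, hi⟩ := Function.ne_iff.1 y.rep_nonzero
  have h : ∀ l, y.rep i * x.rep l = y.rep l * x.rep i := by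
    intro l
    by_contra hl
    -- The `2 × 2` minors against `y` vanish at `y`; if all vanish at `x`, then `x = y`.
    refine hcon (C (y.rep i) * X l - C (y.rep l) * X i)
      ((isHomogeneous_C_mul_X _ _).sub (isHomogeneous_C_mul_X _ _)) ?_ ?_
    · simpa [sub_eq_zero] using hl
    · simp [mul_comm]
  rw [← x.mk_rep, ← y.mk_rep, Projectivization.mk_eq_mk_iff']
  refine ⟨x.rep i / y.rep i, funext fun l => ?_⟩
  have hi' : y.rep i ≠ 0 := hi
  rw [Pi.smul_apply, smul_eq_mul, div_mul_eq_mul_div, div_eq_iff hi']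
  linear_combination -h l

/-- Over a finite field the Zariski topology on a finite-dimensional projective space is
discrete. -/
theorem isOpen_of_finite [Finite k] [Finite σ] (U : Set (ℙ k (σ → k))) :
    IsOpen[zariskiTopology k σ] U := by
  classical
  have : Finite (ℙ k (σ → k)) := Finite.of_injective Projectivization.rep fun x y h => by
    rw [← x.mk_rep, ← y.mk_rep]
    simp only [h]
  have := Fintype.ofFinite (ℙ k (σ → k))
  refine isOpen_of_forall_exists_isHomogeneous fun x hx => ?_
  choose! F hF hFx hFy using fun y (hy : y ∉ U) =>
    exists_linear_form_separating (x := x) (y := y) fun h => hy (h ▸ hx)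
  refine ⟨_, ∏ y with y ∉ U, F y, IsHomogeneous.prod _ F (fun _ => 1)
    fun y hy => hF y (by simpa using hy), ?_, fun y hy => ?_⟩
  · rw [map_prod, Finset.prod_ne_zero_iff]
    exact fun y hy => hFx y (by simpa using hy)
  · rw [map_prod]
    exact Finset.prod_eq_zero (by simpa using hy) (hFy y hy)

theorem exists_eval_homogeneousComponent_ne_zero {F : MvPolynomial σ k} {a : σ → k}
    (h : eval a F ≠ 0) : ∃ e, eval a (homogeneousComponent e F) ≠ 0 := by
  by_contra! hcon
  apply h
  rw [← sum_homogeneousComponent F, map_sum]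
  exact Finset.sum_eq_zero fun e _ => hcon e

/-- On the line through `a`, `F` restricts to a polynomial in the scalar whose coefficients are the
values at `a` of its homogeneous components. This lets inhomogeneous conditions that are invariant
under scaling be tested by homogeneous ones. -/
theorem exists_unit_eval_smul_ne_zero [Infinite k] {F : MvPolynomial σ k} {a : σ → k} {e : ℕ}
    (h : eval a (homogeneousComponent e F) ≠ 0) : ∃ c : kˣ, eval (c • a) F ≠ 0 := by
  by_contra! hcon
  let f : Polynomial k := ∑ i ∈ Finset.range (F.totalDegree + 1),
    Polynomial.C (eval a (homogeneousComponent i F)) * Polynomial.X ^ i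
  have hf : ∀ c, f.eval c = eval (c • a) F := by
    intro c
    conv_rhs => rw [← sum_homogeneousComponent F, map_sum]
    simp only [f, Polynomial.eval_finsetSum]
    refine Finset.sum_congr rfl fun i _ => ?_
    rw [eval_smul_eq (homogeneousComponent_isHomogeneous i F), Polynomial.eval_mul,
      Polynomial.eval_C, Polynomial.eval_pow, Polynomial.eval_X, mul_comm]
  -- The factor `X` takes care of the scalar `0`, about which nothing is assumed.
  have hf0 : Polynomial.X * f = 0 := by
    refine Polynomial.funext fun c => ?_
    rcases eq_or_ne c 0 with rfl | hc
    · simp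
    · have := hcon (Units.mk0 c hc)
      rw [Units.smul_def, Units.val_mk0, ← hf] at this
      simp [this]
  have he : e ∈ Finset.range (F.totalDegree + 1) := by
    rw [Finset.mem_range]
    by_contra he
    exact h (by rw [homogeneousComponent_eq_zero e F (by omega), map_zero])
  have hcoeff : f.coeff e = eval a (homogeneousComponent e F) := by
    simp only [f, Polynomial.finsetSum_coeff, Polynomial.coeff_C_mul_X_pow]
    rw [Finset.sum_ite_eq, if_pos he]
  rw [mul_eq_zero, or_iff_right Polynomial.X_ne_zero] at hf0
  exact h (by rw [← hcoeff, hf0, Polynomial.coeff_zero])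

end ZariskiTopology

/-! ### Openness and non-emptiness of the locus -/

section Openness

variable {k : Type*} [Field k] {n d : ℕ} {p : Ideal (MvPolynomial (Fin (n + 1)) k)}

theorem form_vecMul {ι : Type*} [Fintype ι] (v : ι → k) (M : Matrix ι (Monomials n d) k) :
    form (Matrix.vecMul v M) = ∑ i, C (v i) * form (M i) := by
  let L : (Monomials n d → k) →ₗ[k] MvPolynomial (Fin (n + 1)) k :=
    { toFun := form
      map_add' := form_add
      map_smul' := fun c a => by rw [form_smul, C_mul', RingHom.id_apply] }
  have h : L (Matrix.vecMul v M) = ∑ i, v i • L (M i) := by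
    rw [Matrix.vecMul_eq_sum, map_sum]
    simp_rw [map_smul]
  simp_rw [C_mul']
  exact h

theorem exists_eval_eq_coeff {r : ℕ} (H : Fin r → MvPolynomial (Fin (n + 1)) k)
    (T : MvPolynomial (Fin (n + 1)) k) (β : Fin (n + 1) →₀ ℕ) :
    ∃ P : MvPolynomial (Fin r × Monomials n d) k,
      ∀ b, eval b P = coeff β (∑ i, (form fun m => b (i, m)) * H i + T) := by
  refine ⟨∑ i, ∑ m : Monomials n d, X (i, m) *
    C (coeff β (monomial (m : Fin (n + 1) →₀ ℕ) 1 * H i)) + C (coeff β T), fun b => ?_⟩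
  rw [map_add, eval_C, coeff_add, map_sum, coeff_sum, add_left_inj]
  refine Finset.sum_congr rfl fun i _ => ?_
  rw [map_sum, form, Finset.sum_mul, coeff_sum]
  refine Finset.sum_congr rfl fun m _ => ?_
  rw [map_mul, eval_X, eval_C, ← coeff_C_mul, ← mul_assoc, C_mul_monomial, mul_one]

/-- Being primary to the irrelevant ideal is detected by non-vanishing of polynomials in the
coefficients of the forms. -/
theorem exists_eval_ne_zero_imp_irrelevantIdeal_le_radical
    (hhom : p.IsHomogeneous (homogeneousSubmodule (Fin (n + 1)) k)) {r : ℕ}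
    (b₀ : Fin r × Monomials n d → k) (hb₀ : irrelevantIdeal p ≤ (formsIdeal p b₀).radical) :
    ∃ P : MvPolynomial (Fin r × Monomials n d) k, eval b₀ P ≠ 0 ∧
      ∀ b, eval b P ≠ 0 → irrelevantIdeal p ≤ (formsIdeal p b).radical := by
  classical
  have hle : idealOfVars (Fin (n + 1)) k ≤
      ((formsIdeal p b₀).comap (Ideal.Quotient.mk p)).radical := by
    rw [← Ideal.comap_radical]
    exact Ideal.map_le_iff_le_comap.1 hb₀
  obtain ⟨N, hN⟩ := Ideal.exists_pow_le_of_le_radical_of_fg hle (idealOfVars_fg _ _)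
  have hmem : ∀ α : Monomials n N, ∃ H : Fin r → MvPolynomial (Fin (n + 1)) k,
      monomial (α : Fin (n + 1) →₀ ℕ) 1 - ∑ i, (form fun m => b₀ (i, m)) * H i ∈ p := by
    intro α
    have hα : Ideal.Quotient.mk p (monomial (α : Fin (n + 1) →₀ ℕ) 1) ∈ formsIdeal p b₀ :=
      hN (mem_idealOfVars_of_isHomogeneous (isHomogeneous_monomial _ (degree_monomials α)))
    obtain ⟨c, hc⟩ := (Ideal.mem_span_range_iff_exists_fun).1 hα
    choose H hH using fun i => Ideal.Quotient.mk_surjective (c i)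
    refine ⟨H, ?_⟩
    rw [← Ideal.Quotient.eq_zero_iff_mem, map_sub, map_sum, ← hc, sub_eq_zero]
    exact Finset.sum_congr rfl fun i _ => by rw [map_mul, hH, mul_comm]
  choose H hH using hmem
  -- Each monomial of degree `N` is written as a combination of the forms of `b₀` plus an element `T
  -- α` of `p`. Keeping `H` and `T` fixed while `b` varies gives a matrix `E'` with entries
  -- polynomial in `b`, equal to the identity at `b₀`.
  set T : Monomials n N → MvPolynomial (Fin (n + 1)) k := fun α =>
    monomial (α : Fin (n + 1) →₀ ℕ) 1 - ∑ i, (form fun m => b₀ (i, m)) * H α i with hT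
  choose E hE using fun α β : Monomials n N =>
    exists_eval_eq_coeff (d := d) (H α) (T α) (β : Fin (n + 1) →₀ ℕ)
  let E' : Matrix (Monomials n N) (Monomials n N) (MvPolynomial (Fin r × Monomials n d) k) :=
    Matrix.of E
  refine ⟨E'.det, ?_, fun b hb => ?_⟩
  · have h1 : (eval b₀).mapMatrix E' = 1 := by
      ext α β
      rw [RingHom.mapMatrix_apply, Matrix.map_apply, show E' α β = E α β from rfl, hE]
      simp only [hT, add_sub_cancel, coeff_monomial, Matrix.one_apply, Subtype.coe_inj]
    rw [RingHom.map_det, h1, Matrix.det_one]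
    exact one_ne_zero
  · set M := (eval b).mapMatrix E' with hM
    rw [RingHom.map_det] at hb
    have hrow : ∀ α, Ideal.Quotient.mk p (form (M α)) ∈ formsIdeal p b := by
      intro α
      have h1 : ∑ i, (form fun m => b (i, m)) * H α i + T α ∈ (formsIdeal p b).comap (Ideal.Quotient.mk p) := by
        refine Ideal.add_mem _ (Ideal.sum_mem _ fun i _ => Ideal.mul_mem_right _ _ ?_) ?_
        · exact Ideal.subset_span ⟨i, rfl⟩
        · rw [Ideal.mem_comap, Ideal.Quotient.eq_zero_iff_mem.2 (hH α)]
          exact zero_mem _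
      have h2 := homogeneousComponent_mem_of_mem (isHomogeneous_comap_formsIdeal hhom b) h1 N
      have h3 : M α = fun β : Monomials n N =>
          coeff (β : Fin (n + 1) →₀ ℕ) 
            (homogeneousComponent N (∑ i, (form fun m => b (i, m)) * H α i + T α)) := by
        funext β
        rw [coeff_homogeneousComponent, if_pos (degree_monomials β), ← hE]
        rfl
      rw [h3, form_coeff (homogeneousComponent_isHomogeneous _ _)]
      exact h2
    -- Where the determinant is non-zero, the rows span all forms of degree `N`.
    have hall : ∀ c : Monomials n N → k, Ideal.Quotient.mk p (form c) ∈ formsIdeal p b := by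
      intro c
      have hc : c = Matrix.vecMul (Matrix.vecMul c M⁻¹) M := by
        rw [Matrix.vecMul_vecMul, Matrix.nonsing_inv_mul _ (isUnit_iff_ne_zero.2 hb),
          Matrix.vecMul_one]
      rw [hc, form_vecMul, map_sum]
      refine Ideal.sum_mem _ fun α _ => ?_
      rw [map_mul]
      exact Ideal.mul_mem_left _ _ (hrow α)
    rw [Ideal.radical_eq_sInf]
    refine le_sInf fun q ⟨hbq, hq⟩ => ?_
    exact irrelevantIdeal_le_of_forall_form_mem (d := N) q fun c => hbq (hall c)

theorem isOpen_principalLocus (hp : p.IsPrime)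
    (hhom : p.IsHomogeneous (homogeneousSubmodule (Fin (n + 1)) k)) (hd : 1 ≤ d) {j : ℕ}
    (hj : (j : WithBot ℕ∞) ≤ ringKrullDim (MvPolynomial (Fin (n + 1)) k ⧸ p)) :
    IsOpen[zariskiTopology k (Fin j × Monomials n d)] (principalLocus p d j) := by
  classical
  cases finite_or_infinite k
  · exact isOpen_of_finite _
  have hdim := ringKrullDim_eq_height_irrelevantIdeal hp hhom
  have := irrelevantIdeal_isPrime hp.ne_top hhom
  obtain ⟨r, hr⟩ :=
    ENat.ne_top_iff_exists.1 (Ideal.height_ne_top_of_isPrime (I := irrelevantIdeal p))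
  rw [← hr] at hdim
  have hjr : j ≤ r := by
    rw [hdim] at hj
    exact Nat.cast_le.1 (WithBot.coe_le_coe.1 hj)
  refine isOpen_of_forall_exists_isHomogeneous fun x hx => ?_
  obtain ⟨b₀, hb₀x, hb₀⟩ := exists_extension_le_height x.rep (ge_of_eq hx) r hjr hr.le
  obtain ⟨P, hP₀, hP⟩ := exists_eval_ne_zero_imp_irrelevantIdeal_le_radical hhom b₀
    (irrelevantIdeal_le_radical hp hhom b₀ hb₀ hr.ge)
  -- The completing forms of `b₀` stay fixed and only the first `j` vary. `Q` is `P` restricted to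
  -- this affine subspace, hence in general not homogeneous.
  let ext (a : Fin j × Monomials n d → k) : Fin r × Monomials n d → k :=
    fun y => if h : (y.1 : ℕ) < j then a (⟨y.1, h⟩, y.2) else b₀ y
  let Q : MvPolynomial (Fin j × Monomials n d) k :=
    bind₁ (fun y => if h : (y.1 : ℕ) < j then X (⟨y.1, h⟩, y.2) else C (b₀ y)) P
  have hQ : ∀ a, eval a Q = eval (ext a) P := by
    intro a
    simp only [Q, eval, ext]
    rw [eval₂Hom_bind₁]
    congr 2
    funext y
    split_ifs <;> simp
  have hx₀ : ext x.rep = b₀ := by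
    funext y
    simp only [ext]
    split_ifs with h
    · exact (hb₀x ⟨y.1, h⟩ y.2).symm
    · rfl
  obtain ⟨e, he⟩ := exists_eval_homogeneousComponent_ne_zero (F := Q) (a := x.rep)
    (by rwa [hQ, hx₀])
  refine ⟨e, _, homogeneousComponent_isHomogeneous e Q, he, fun y hy => ?_⟩
  by_contra hye
  -- Rescaling `y` makes `Q` itself non-zero without changing the ideal of the `j` forms.
  obtain ⟨c, hc⟩ := exists_unit_eval_smul_ne_zero hye
  rw [hQ] at hc
  refine hy (le_antisymm (height_formsIdeal_le hp.ne_top hhom hd _) ?_)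
  rw [← formsIdeal_smul p c]
  exact le_height_of_irrelevantIdeal_le_radical hp hd hhom hdim.ge hjr _ (hP _ hc) _
    fun l m => by simp [ext]

theorem principalLocus_nonempty [Infinite k] (hp : p.IsPrime)
    (hhom : p.IsHomogeneous (homogeneousSubmodule (Fin (n + 1)) k)) (hd : 1 ≤ d) {j : ℕ}
    (hj1 : 1 ≤ j) (hj : (j : WithBot ℕ∞) ≤ ringKrullDim (MvPolynomial (Fin (n + 1)) k ⧸ p)) :
    (principalLocus p d j).Nonempty := by
  rw [ringKrullDim_eq_height_irrelevantIdeal hp hhom] at hj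
  obtain ⟨a, -, ha⟩ := exists_extension_le_height (p := p) (d := d)
    (0 : Fin 0 × Monomials n d → k) (by simp) j (Nat.zero_le j) (WithBot.coe_le_coe.1 hj)
  -- A zero tuple would generate the zero ideal, of height `0 < j`, so `a` defines a projective
  -- point.
  have ha0 : a ≠ 0 := by
    rintro rfl
    have hbot : formsIdeal p (0 : Fin j × Monomials n d → k) = ⊥ := by
      rw [eq_bot_iff, formsIdeal, Ideal.span_le]
      rintro _ ⟨i, rfl⟩
      have h0 : Ideal.Quotient.mk p (form fun m : Monomials n d =>
          (0 : Fin j × Monomials n d → k) (i, m)) = 0 :=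
        (congrArg _ form_zero).trans (map_zero _)
      exact h0
    rw [hbot, Ideal.height_bot] at ha
    have := Nat.cast_le.1 (ha.trans_eq Nat.cast_zero.symm)
    omega
  exact ⟨.mk k a ha0, (mk_mem_principalLocus p a ha0).2
    (le_antisymm (height_formsIdeal_le hp.ne_top hhom hd a) ha)⟩

/-! ### Properness of the locus -/

theorem form_notMem_of_forall {a : Monomials n d → k} (ha : a ≠ 0)
    (h : ¬ ∃ f ∈ p, f ≠ 0 ∧ f.IsHomogeneous d) : form a ∉ p :=
  fun hf => h ⟨_, hf, (form_eq_zero_iff a).not.2 ha, isHomogeneous_form a⟩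

theorem principalLocus_ne_univ_iff (hp : p.IsPrime)
    (hhom : p.IsHomogeneous (homogeneousSubmodule (Fin (n + 1)) k)) (hd : 1 ≤ d) {j : ℕ}
    (hj1 : 1 ≤ j) :
    principalLocus p d j ≠ Set.univ ↔ 2 ≤ j ∨ ∃ f ∈ p, f ≠ 0 ∧ f.IsHomogeneous d := by
  classical
  constructor
  · intro hne
    by_contra! hcon
    obtain ⟨hj, hf⟩ := hcon
    obtain rfl : j = 1 := by omega
    refine hne (Set.eq_univ_of_forall fun x => ?_)
    refine le_antisymm (height_formsIdeal_le hp.ne_top hhom hd _) ?_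
    have hx : (fun m => x.rep (0, m)) ≠ 0 := fun h => x.rep_nonzero <| by
      funext y
      rw [← Prod.mk.eta (p := y), Subsingleton.elim y.1 0]
      exact congrFun h y.2
    have hmk : Ideal.Quotient.mk p (form fun m => x.rep (0, m)) ≠ 0 := fun h =>
      form_notMem_of_forall hx (by push Not; exact hf) (Ideal.Quotient.eq_zero_iff_mem.1 h)
    refine le_trans (b := (Ideal.span {Ideal.Quotient.mk p (form fun m => x.rep (0, m))}).height)
      ?_ (Ideal.height_mono ?_)
    · exact_mod_cast Ideal.one_le_height_span_singleton_of_mem_nonZeroDivisors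
        (mem_nonZeroDivisors_of_ne_zero hmk)
    · rw [Ideal.span_singleton_le_iff_mem]
      exact Ideal.subset_span ⟨0, rfl⟩
  · intro h
    have : ∃ c : Monomials n d → k, c ≠ 0 ∧ (2 ≤ j ∨ form c ∈ p) := by
      rcases h with h | ⟨f, hf, hf0, hfd⟩
      · refine ⟨fun m => coeff (m : Fin (n + 1) →₀ ℕ) (X 0 ^ d), fun h0 => ?_, .inl h⟩
        have := (form_eq_zero_iff _).2 h0
        rw [form_coeff (isHomogeneous_X_pow 0 d)] at this
        exact pow_ne_zero _ (X_ne_zero _) this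
      · refine ⟨fun m => coeff (m : Fin (n + 1) →₀ ℕ) f, fun h0 => hf0 ?_, .inr ?_⟩
        · rw [← form_coeff hfd, h0, form_zero]
        · rwa [form_coeff hfd]
    obtain ⟨c, hc0, hc⟩ := this
    -- The tuple `(c, 0, …, 0)` generates a principal ideal, of height at most `1`, and of height
    -- `0` when the form lies in `p`.
    let a : Fin j × Monomials n d → k := fun y => if (y.1 : ℕ) = 0 then c y.2 else 0
    have ha0 : a ≠ 0 := fun h => hc0 <| funext fun m => by
      simpa [a] using congrFun h (⟨0, hj1⟩, m)
    have hle : formsIdeal p a ≤ Ideal.span {Ideal.Quotient.mk p (form c)} := by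
      refine Ideal.span_le.2 ?_
      rintro _ ⟨i, rfl⟩
      by_cases hi : (i : ℕ) = 0
      · simp [a, hi]
      · have h0 : (form fun m => a (i, m)) = 0 := by
          simp only [a, hi, if_false]
          exact form_zero
        simp [h0]
    intro huniv
    have hmem : Projectivization.mk k a ha0 ∈ principalLocus p d j := huniv ▸ Set.mem_univ _
    rw [mk_mem_principalLocus] at hmem
    have h1 := hmem.ge.trans (Ideal.height_mono hle)
    rcases hc with hj2 | hcp
    · have hunit : ¬ IsUnit (Ideal.Quotient.mk p (form c)) := fun hu =>
        (irrelevantIdeal_isPrime hp.ne_top hhom).ne_top (Ideal.eq_top_of_isUnit_mem _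
          (Ideal.mem_map_of_mem _ (form_mem_idealOfVars hd c)) hu)
      have h2 := h1.trans (Ideal.height_span_singleton_le_one hunit)
      have := Nat.cast_le.1 (h2.trans_eq Nat.cast_one.symm)
      omega
    · rw [Ideal.Quotient.eq_zero_iff_mem.2 hcp, Ideal.span_singleton_eq_bot.2 rfl,
        Ideal.height_bot] at h1
      have := Nat.cast_le.1 (h1.trans_eq Nat.cast_zero.symm)
      omega

end Openness

end PrincipalClass

end

theorem theorem2 {k : Type*} [Field k] (n : ℕ)
    (p : Ideal (MvPolynomial (Fin (n + 1)) k)) (hprime : p.IsPrime)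
    (hhom : p.IsHomogeneous (MvPolynomial.homogeneousSubmodule (Fin (n + 1)) k))
    (d : ℕ) (hd : 1 ≤ d) (j : ℕ) (hj : 1 ≤ j)
    (hjr : (j : WithBot ℕ∞) ≤ ringKrullDim (MvPolynomial (Fin (n + 1)) k ⧸ p)) :
    IsOpen[PrincipalClass.zariskiTopology k (Fin j × PrincipalClass.Monomials n d)]
      (PrincipalClass.principalLocus p d j) ∧
    (Infinite k → (PrincipalClass.principalLocus p d j).Nonempty) ∧
    (PrincipalClass.principalLocus p d j ≠ Set.univ ↔
      2 ≤ j ∨ ∃ f ∈ p, f ≠ 0 ∧ f.IsHomogeneous d) :=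
  ⟨PrincipalClass.isOpen_principalLocus hprime hhom hd hjr,
    fun _ => PrincipalClass.principalLocus_nonempty hprime hhom hd hj hjr,
    PrincipalClass.principalLocus_ne_univ_iff hprime hhom hd hj⟩
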